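/- Consider superchannels acting on channels of a qubit, that is, maps implemented as $$\Xi[\mathcal E](\rho)=\mathrm{Tr}_{D''}\circ\mathcal N_{de}\circ(\mathcal E\otimes\mathcal I_D)\circ\mathcal N_{en}(\rho\otimes\tau),$$ with finite-dimensional memory systems $D',D,D''$, a state $\tau$ of $D'$, and encoding and decoding channels $\mathcal N_{en}:A\otimes D'\to A\otimes D$ and $\mathcal N_{de}:A\otimes D\to A\otimes D''$. The memory of such an implementation is passive if $\mathrm{Tr}_1[\mathcal N_{en}(\rho\otimes\tau)]$ does not depend on the input state $\rho$ of the system. A superchannel $\Xi$ is dephasing if $\langle i|\Xi[\mathcal E](|j\rangle\langle j|)|i\rangle=\langle i|\mathcal E(|j\rangle\langle j|)|i\rangle$ for all channels $\mathcal E$ and all $i,j$; its Gram matrix is the positive semidefinite matrix $\mathbf C$ with unit diagonal such that $J(\Xi[\mathcal E])=J(\mathcal E)\odot\mathbf C$ for all channels $\mathcal E$, where $J(\mathcal E)=(\mathcal E\otimes\mathcal I)(|\Psi\rangle\langle\Psi|)$ is the Jamiołkowski state and $\odot$ the entrywise product. The rows and columns of $\mathbf C$ are indexed by pairs $ik$ ($i$: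 output, $k$: input), and $C_{ij}=(\mathbf C_{ik,jl})_{k,l}$ denotes its $2\times2$ blocks. Let $S$ be the set of Gram matrices of those dephasing superchannels on qubit channels that have an implementation with a passive memory, let $D_{l_1}(G,H)=\sum_{i,j}|G_{ij}-H_{ij}|$, and let $\mathcal L_\star$ be the linear map on $2\times2$ matrices with $\mathcal L_\star\big(\tfrac12(I+r_1\sigma_1+r_2\sigma_2+r_3\sigma_3)\big)=\tfrac12(I+r_1\sigma_1+r_2\sigma_2)$ for all real $r_1,r_2,r_3$, which projects the Bloch ball onto the $x$–$y$ plane. Theorem. For every dephasing superchannel $\Xi_{\mathbf C}$ on qubit channels with Gram matrix $\mathbf C$, the minimum below exists, and the amount of active memory needed to realize $\Xi_{\mathbf C}$ is $$M(\Xi_{\mathbf C})=\min_{\mathbf C_\star\in S}D_{l_1}(\mathbf C,\mathbf C_\star)=2\,|\mathbf C_{00,10}-\mathbf C_{01,11}|,$$ that is, twice the modulus of the difference of the two diagonal entries of the block $C_{01}$. The minimum is attained at $(\mathcal I\otimes\mathcal L_\star)(\mathbf C)$, which belongs to $S$. -/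

import Mathlib

open scoped ComplexOrder Matrix Kronecker

namespace DephasingMemory

noncomputable section

/-- Linear maps from `m × m` to `n × n` complex matrices (superoperators). -/
abbrev SuperOp (m n : Type) := Matrix m m ℂ →ₗ[ℂ] Matrix n n ℂ

/-- A density matrix: positive semidefinite with trace one. -/
def IsState {n : Type} [Fintype n] (ρ : Matrix n n ℂ) : Prop :=
  ρ.PosSemidef ∧ ρ.trace = 1

/-- A Gram (correlation) matrix: positive semidefinite with all diagonal entries equal to one. -/
def IsGram {n : Type} (C : Matrix n n ℂ) : Prop :=
  C.PosSemidef ∧ ∀ i, C i i = 1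

/-- The `(a, b)` block of a matrix on `n ⊗ r`, where `a, b` index the second factor. -/
def blockRight {n r : Type} (X : Matrix (n × r) (n × r) ℂ) (a b : r) : Matrix n n ℂ :=
  Matrix.of fun i j => X (i, a) (j, b)

/-- The `(i, j)` block of a matrix on `n ⊗ r`, where `i, j` index the first factor. -/
def blockLeft {n r : Type} (X : Matrix (n × r) (n × r) ℂ) (i j : n) : Matrix r r ℂ :=
  Matrix.of fun a b => X (i, a) (j, b)

/-- The map `Φ ⊗ id_r`. -/
def tensorId {m n : Type} (r : Type) (Φ : SuperOp m n) : SuperOp (m × r) (n × r) where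
  toFun X := Matrix.of fun p q => Φ (blockRight X p.2 q.2) p.1 q.1
  map_add' X Y := by
    ext p q
    have h : blockRight (X + Y) p.2 q.2 = blockRight X p.2 q.2 + blockRight Y p.2 q.2 := rfl
    simp [h]
  map_smul' c X := by
    ext p q
    have h : blockRight (c • X) p.2 q.2 = c • blockRight X p.2 q.2 := rfl
    simp [h]

/-- The map `id_r ⊗ Φ`. -/
def idTensor {m n : Type} (r : Type) (Φ : SuperOp m n) : SuperOp (r × m) (r × n) where
  toFun X := Matrix.of fun p q => Φ (blockLeft X p.1 q.1) p.2 q.2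
  map_add' X Y := by
    ext p q
    have h : blockLeft (X + Y) p.1 q.1 = blockLeft X p.1 q.1 + blockLeft Y p.1 q.1 := rfl
    simp [h]
  map_smul' c X := by
    ext p q
    have h : blockLeft (c • X) p.1 q.1 = c • blockLeft X p.1 q.1 := rfl
    simp [h]

/-- Partial trace over the first tensor factor. -/
def trace₁ {n r : Type} [Fintype n] (X : Matrix (n × r) (n × r) ℂ) : Matrix r r ℂ :=
  Matrix.of fun a b => ∑ i, X (i, a) (i, b)

/-- Partial trace over the second tensor factor, as a linear map. -/
def trace₂ (n r : Type) [Fintype r] : SuperOp (n × r) n where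
  toFun X := Matrix.of fun i j => ∑ a, X (i, a) (j, a)
  map_add' X Y := by ext i j; simp [Finset.sum_add_distrib]
  map_smul' c X := by ext i j; simp [Finset.mul_sum]

/-- Appending a second system in the state `τ`: the linear map `ρ ↦ ρ ⊗ τ`. -/
def appendState {r : Type} (n : Type) (τ : Matrix r r ℂ) : SuperOp n (n × r) where
  toFun ρ := ρ ⊗ₖ τ
  map_add' X Y := Matrix.add_kronecker X Y τ
  map_smul' c X := Matrix.smul_kronecker c X τ

/-- Complete positivity: every `Φ ⊗ id_k` preserves positive semidefiniteness. -/
def IsCompletelyPositive {m n : Type} [Fintype m] [Fintype n] (Φ : SuperOp m n) : Prop :=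
  ∀ k : ℕ, ∀ X : Matrix (m × Fin k) (m × Fin k) ℂ, X.PosSemidef →
    (tensorId (Fin k) Φ X).PosSemidef

/-- Quantum channels: completely positive trace-preserving linear maps. -/
def IsChannel {m n : Type} [Fintype m] [Fintype n] (Φ : SuperOp m n) : Prop :=
  IsCompletelyPositive Φ ∧ ∀ X, (Φ X).trace = X.trace

/-- The projector on the maximally entangled vector `d^{-1/2} ∑ᵢ |ii⟩`. -/
def maxEntangled (d : ℕ) : Matrix (Fin d × Fin d) (Fin d × Fin d) ℂ :=
  Matrix.of fun p q => if p.1 = p.2 ∧ q.1 = q.2 then (1 / (d : ℂ)) else 0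

/-- The Jamiołkowski state `J(E) = (E ⊗ id)(|Ψ⟩⟨Ψ|)`; the first index of a pair refers to the
output of `E`, the second to its input. -/
def jamiolkowski {d : ℕ} (E : SuperOp (Fin d) (Fin d)) :
    Matrix (Fin d × Fin d) (Fin d × Fin d) ℂ :=
  tensorId (Fin d) E (maxEntangled d)

/-- A physical implementation of a superchannel on channels of a `d`-level system: memory systems
`D', D, D''`, an initial memory state `τ` on `D'`, an encoding channel `A ⊗ D' → A ⊗ D` and a
decoding channel `A ⊗ D → A ⊗ D''`. -/
structure Implementation (d : ℕ) where
  /-- dimension of `D'` -/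
  dim' : ℕ
  /-- dimension of `D` -/
  dim : ℕ
  /-- dimension of `D''` -/
  dim'' : ℕ
  /-- initial state of the memory -/
  τ : Matrix (Fin dim') (Fin dim') ℂ
  τ_isState : IsState τ
  /-- encoding (pre-processing) -/
  enc : SuperOp (Fin d × Fin dim') (Fin d × Fin dim)
  enc_isChannel : IsChannel enc
  /-- decoding (post-processing) -/
  dec : SuperOp (Fin d × Fin dim) (Fin d × Fin dim'')
  dec_isChannel : IsChannel dec

/-- The implemented action
`E ↦ Tr_{D''} ∘ N_de ∘ (E ⊗ id_D) ∘ N_en (· ⊗ τ)`. -/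
def Implementation.action {d : ℕ} (R : Implementation d) (E : SuperOp (Fin d) (Fin d)) :
    SuperOp (Fin d) (Fin d) :=
  trace₂ (Fin d) (Fin R.dim'') ∘ₗ R.dec ∘ₗ tensorId (Fin R.dim) E ∘ₗ R.enc ∘ₗ
    appendState (Fin d) R.τ

/-- `R` implements `Ξ`: the two agree on all channels. -/
def Implementation.Implements {d : ℕ} (R : Implementation d)
    (Ξ : SuperOp (Fin d) (Fin d) → SuperOp (Fin d) (Fin d)) : Prop :=
  ∀ E, IsChannel E → Ξ E = R.action E

/-- The memory is passive: the memory state `Tr₁[N_en(ρ ⊗ τ)]` after the encoding does not depend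
on the input state `ρ` of the system. -/
def Implementation.IsPassive {d : ℕ} (R : Implementation d) : Prop :=
  ∀ ρ ρ' : Matrix (Fin d) (Fin d) ℂ, IsState ρ → IsState ρ' →
    trace₁ (R.enc (ρ ⊗ₖ R.τ)) = trace₁ (R.enc (ρ' ⊗ₖ R.τ))

/-- A superchannel on channels of a `d`-level system. -/
def IsSuperchannel {d : ℕ} (Ξ : SuperOp (Fin d) (Fin d) → SuperOp (Fin d) (Fin d)) : Prop :=
  ∃ R : Implementation d, R.Implements Ξ

/-- A dephasing superchannel: a superchannel that leaves the transition probabilities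
`⟨i| E(|j⟩⟨j|) |i⟩` of every channel `E` unchanged. -/
def IsDephasingSuperchannel {d : ℕ}
    (Ξ : SuperOp (Fin d) (Fin d) → SuperOp (Fin d) (Fin d)) : Prop :=
  IsSuperchannel Ξ ∧ ∀ E, IsChannel E → ∀ i j : Fin d,
    Ξ E (Matrix.single j j 1) i i = E (Matrix.single j j 1) i i

/-- `C` is the Gram matrix identifying `Ξ`: `J(Ξ[E]) = J(E) ⊙ C` for every channel `E`. -/
def IsGramMatrixOf {d : ℕ} (C : Matrix (Fin d × Fin d) (Fin d × Fin d) ℂ)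
    (Ξ : SuperOp (Fin d) (Fin d) → SuperOp (Fin d) (Fin d)) : Prop :=
  IsGram C ∧ ∀ E, IsChannel E → jamiolkowski (Ξ E) = jamiolkowski E ⊙ C

/-- The set of Gram matrices of those dephasing superchannels that can be implemented with a
passive memory. -/
def passiveGrams (d : ℕ) : Set (Matrix (Fin d × Fin d) (Fin d × Fin d) ℂ) :=
  {C | ∃ Ξ : SuperOp (Fin d) (Fin d) → SuperOp (Fin d) (Fin d),
    IsDephasingSuperchannel Ξ ∧ IsGramMatrixOf C Ξ ∧
      ∃ R : Implementation d, R.IsPassive ∧ R.Implements Ξ}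

/-- The entrywise `l₁` distance of two matrices. -/
def l1Dist {n : Type} [Fintype n] (G H : Matrix n n ℂ) : ℝ :=
  ∑ i, ∑ j, ‖G i j - H i j‖

/-- The amount of active memory of the dephasing superchannel with Gram matrix `C`, with respect
to the `l₁` distance. -/
def activeMemory {d : ℕ} (C : Matrix (Fin d × Fin d) (Fin d × Fin d) ℂ) : ℝ :=
  sInf (l1Dist C '' passiveGrams d)

/-- The Pauli matrix `σ_x`. -/
def pauliX : Matrix (Fin 2) (Fin 2) ℂ := !![0, 1; 1, 0]

/-- The Pauli matrix `σ_y`. -/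
def pauliY : Matrix (Fin 2) (Fin 2) ℂ := !![0, -Complex.I; Complex.I, 0]

/-- The linear map `L_⋆` on qubit operators that projects the Bloch ball onto the `x`-`y` plane:
`ρ = (I + r·σ)/2` is sent to `(I + r₁ σ_x + r₂ σ_y)/2`, where `rⱼ = Tr(ρ σⱼ)`. -/
def blochProjXY : SuperOp (Fin 2) (Fin 2) where
  toFun ρ := (1 / 2 : ℂ) •
    (ρ.trace • 1 + (ρ * pauliX).trace • pauliX + (ρ * pauliY).trace • pauliY)
  map_add' X Y := by
    simp only [Matrix.add_mul, Matrix.trace_add, add_smul, ← smul_add]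
    congr 1
    abel
  map_smul' c X := by
    simp only [Matrix.smul_mul, Matrix.trace_smul, smul_eq_mul, mul_smul, smul_add,
      RingHom.id_apply, smul_comm c (1 / 2 : ℂ)]

end

end DephasingMemory

/-! The argument has a lower bound and a construction.

Lower bound. If the memory is passive, apply the superchannel to the channel that replaces every
input by the fixed state `|+⟩⟨+|`. What reaches the decoder is that state together with the memory,
and by passivity neither depends on the input; hence `G (i, k) (j, k)` does not depend on `k` for any
`G` in `passiveGrams` (`gram_apply_eq_of_passive`). The triangle inequality on the entries
`(00, 10)`, `(01, 11)` and their mirror images then gives the bound.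

Construction. The output of a superchannel is trace preserving, which forces the two diagonal blocks
of `C` to coincide (`gram_diagonal_blocks_eq`). As a consequence, although `blochProjXY` is not
completely positive, `idTensor (Fin 2) blochProjXY C` is the average of `C` and
`(X ⊗ X) Cᵀ (X ⊗ X)` (`idTensor_blochProjXY_apply`). So it is positive and invariant under the
antiunitary `x ↦ (X ⊗ X) x̄`, and it is a sum of dyads `x xᴴ` of vectors fixed by it
(`exists_flipReal_family`). Its unit diagonal says that the functional `|x₀₀|² - |x₀₁|²` sums to zero
over the family; rotating pairs of vectors in which it has opposite signs, one makes it vanish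
on every vector (`exists_balanced_family`, the rank-one decomposition of Sturm and Zhang). A fixed
vector with `|x₀₀| = |x₀₁|` has entries of equal modulus and satisfies `x₀₀ x₁₁ = x₀₁ x₁₀`, so it is a
product of phases `v i * w k` up to scale (`exists_phases`). The matrix is therefore a mixture of
product phase patterns, which is implemented by diagonal unitaries before and after the channel,
controlled by a classical random variable kept in the memory; such a memory is passive
(`mem_passiveGrams_of_phases`). -/

namespace DephasingMemory

open Complex
open scoped ComplexOrder Matrix Kronecker ComplexConjugate

/-! ### Unitary and replacement channels -/

/-- The map `X ↦ U X Uᴴ`. -/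
def unitaryConj {n : Type} [Fintype n] (U : Matrix n n ℂ) : SuperOp n n where
  toFun X := U * X * Uᴴ
  map_add' X Y := by rw [Matrix.mul_add, Matrix.add_mul]
  map_smul' c X := by simp

theorem unitaryConj_apply {n : Type} [Fintype n] (U X : Matrix n n ℂ) :
    unitaryConj U X = U * X * Uᴴ := rfl

theorem unitaryConj_diagonal_apply {n : Type} [Fintype n] [DecidableEq n] (u : n → ℂ)
    (X : Matrix n n ℂ) (x y : n) :
    unitaryConj (Matrix.diagonal u) X x y = u x * X x y * conj (u y) := by
  rw [unitaryConj_apply, Matrix.diagonal_conjTranspose, Matrix.mul_diagonal, Matrix.diagonal_mul]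
  rfl

theorem tensorId_unitaryConj {n r : Type} [Fintype n] [Fintype r] [DecidableEq r]
    (U : Matrix n n ℂ) (X : Matrix (n × r) (n × r) ℂ) :
    tensorId r (unitaryConj U) X = (U ⊗ₖ (1 : Matrix r r ℂ)) * X * (U ⊗ₖ (1 : Matrix r r ℂ))ᴴ := by
  ext ⟨i, a⟩ ⟨j, b⟩
  simp [tensorId, unitaryConj, blockRight, Matrix.mul_apply, Fintype.sum_prod_type,
    Matrix.one_apply, Finset.sum_mul, apply_ite conj]

theorem isChannel_unitaryConj {n : Type} [Fintype n] [DecidableEq n] {U : Matrix n n ℂ}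
    (hU : Uᴴ * U = 1) : IsChannel (unitaryConj U) := by
  refine ⟨fun k X hX => ?_, fun X => ?_⟩
  · rw [tensorId_unitaryConj]
    exact hX.mul_mul_conjTranspose_same _
  · rw [unitaryConj_apply, Matrix.trace_mul_cycle, hU, one_mul]

theorem trace₁_posSemidef {n r : Type} [Fintype n]
    {X : Matrix (n × r) (n × r) ℂ} (hX : X.PosSemidef) : (trace₁ X).PosSemidef := by
  have : trace₁ X = ∑ i, X.submatrix (fun a => (i, a)) (fun a => (i, a)) := by
    ext a b
    simp [trace₁, Matrix.sum_apply]
  rw [this]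
  exact Matrix.posSemidef_sum _ fun i _ => hX.submatrix _

/-- The map `X ↦ tr X • σ`, which discards its input and prepares `σ`. -/
def replaceChannel {n : Type} [Fintype n] (σ : Matrix n n ℂ) : SuperOp n n :=
  (Matrix.traceLinearMap n ℂ ℂ).smulRight σ

theorem replaceChannel_apply {n : Type} [Fintype n] (σ X : Matrix n n ℂ) :
    replaceChannel σ X = X.trace • σ := rfl

theorem tensorId_replaceChannel {n r : Type} [Fintype n]
    (σ : Matrix n n ℂ) (X : Matrix (n × r) (n × r) ℂ) :
    tensorId r (replaceChannel σ) X = σ ⊗ₖ trace₁ X := by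
  ext ⟨i, a⟩ ⟨j, b⟩
  simp [tensorId, replaceChannel_apply, blockRight, trace₁, Matrix.trace, mul_comm]

theorem isChannel_replaceChannel {n : Type} [Fintype n] {σ : Matrix n n ℂ} (hσ : IsState σ) :
    IsChannel (replaceChannel σ) := by
  refine ⟨fun k X hX => ?_, fun X => ?_⟩
  · rw [tensorId_replaceChannel]
    exact hσ.1.kronecker (trace₁_posSemidef hX)
  · rw [replaceChannel_apply, Matrix.trace_smul, hσ.2, smul_eq_mul, mul_one]

theorem isState_single {n : Type} [Fintype n] [DecidableEq n] (k : n) :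
    IsState (Matrix.single k k (1 : ℂ)) := by
  refine ⟨?_, Matrix.trace_single_eq_same k 1⟩
  rw [← Matrix.diagonal_single]
  refine Matrix.posSemidef_diagonal_iff.2 fun i => ?_
  rw [Pi.single_apply]
  split_ifs <;> simp

/-! ### Gram matrices on matrix units -/

theorem blockRight_maxEntangled {d : ℕ} (k l : Fin d) :
    blockRight (maxEntangled d) k l = (1 / (d : ℂ)) • Matrix.single k l (1 : ℂ) := by
  ext i j
  simp [blockRight, maxEntangled, Matrix.single_apply, eq_comm]

theorem jamiolkowski_apply {d : ℕ} (E : SuperOp (Fin d) (Fin d)) (i k j l : Fin d) :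
    jamiolkowski E (i, k) (j, l) = (1 / (d : ℂ)) * E (Matrix.single k l 1) i j := by
  change E (blockRight (maxEntangled d) k l) i j = _
  rw [blockRight_maxEntangled, map_smul, Matrix.smul_apply, smul_eq_mul]

/-- The Gram matrix relation read on matrix units: the superchannel multiplies the matrix element
`⟨i| E(|k⟩⟨l|) |j⟩` by `G (i, k) (j, l)`. -/
theorem jamiolkowski_eq_hadamard_iff {d : ℕ} (hd : d ≠ 0) (E F : SuperOp (Fin d) (Fin d))
    (G : Matrix (Fin d × Fin d) (Fin d × Fin d) ℂ) :
    jamiolkowski F = jamiolkowski E ⊙ G ↔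
      ∀ i j k l, F (Matrix.single k l 1) i j = E (Matrix.single k l 1) i j * G (i, k) (j, l) := by
  have hd' : (d : ℂ) ≠ 0 := Nat.cast_ne_zero.2 hd
  constructor
  · intro h i j k l
    have := congrFun (congrFun h (i, k)) (j, l)
    rw [Matrix.hadamard_apply, jamiolkowski_apply, jamiolkowski_apply, mul_assoc] at this
    exact mul_left_cancel₀ (one_div_ne_zero hd') this
  · intro h
    ext ⟨i, k⟩ ⟨j, l⟩
    rw [Matrix.hadamard_apply, jamiolkowski_apply, jamiolkowski_apply, h, mul_assoc]

/-! ### Trace preservation and the diagonal blocks -/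

theorem trace_tensorId {m n r : Type} [Fintype m] [Fintype n] [Fintype r] {Φ : SuperOp m n}
    (hΦ : ∀ X, (Φ X).trace = X.trace) (X : Matrix (m × r) (m × r) ℂ) :
    (tensorId r Φ X).trace = X.trace := by
  have h := fun a => hΦ (blockRight X a a)
  simp only [Matrix.trace, Matrix.diag_apply] at h
  simp only [Matrix.trace, Matrix.diag_apply, Fintype.sum_prod_type_right]
  exact Finset.sum_congr rfl fun a _ => h a

theorem Implementation.trace_action {d : ℕ} (R : Implementation d) {E : SuperOp (Fin d) (Fin d)}
    (hE : IsChannel E) (X : Matrix (Fin d) (Fin d) ℂ) : (R.action E X).trace = X.trace := by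
  have h2 : ∀ Y, (trace₂ (Fin d) (Fin R.dim'') Y).trace = Y.trace := fun Y => by
    simp [trace₂, Matrix.trace, Fintype.sum_prod_type]
  simp only [Implementation.action, LinearMap.comp_apply]
  rw [h2, R.dec_isChannel.2, trace_tensorId hE.2, R.enc_isChannel.2]
  change (X ⊗ₖ R.τ).trace = _
  rw [Matrix.trace_kronecker, R.τ_isState.2, mul_one]

/-- The two diagonal blocks of the Gram matrix agree. The trace of `E(|0⟩⟨1|)` vanishes before and
after the superchannel acts, so the two opposite diagonal entries of this matrix are multiplied by
the same factor. -/
theorem gram_diagonal_blocks_eq {Ξ : SuperOp (Fin 2) (Fin 2) → SuperOp (Fin 2) (Fin 2)}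
    {C : Matrix (Fin 2 × Fin 2) (Fin 2 × Fin 2) ℂ}
    (hΞ : IsSuperchannel Ξ) (hC : IsGramMatrixOf C Ξ) :
    C (0, 0) (0, 1) = C (1, 0) (1, 1) := by
  obtain ⟨R, hR⟩ := hΞ
  -- A unitary with rational entries for which `U |0⟩⟨1| Uᴴ` has a nonzero diagonal.
  let U : Matrix (Fin 2) (Fin 2) ℂ := !![3 / 5, 4 / 5; 4 / 5, -3 / 5]
  have hUH : Uᴴ = U := by
    ext i j
    fin_cases i <;> fin_cases j <;> simp [U]
  have hU : Uᴴ * U = 1 := by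
    rw [hUH]
    ext i j
    fin_cases i <;> fin_cases j <;> simp [U, Matrix.mul_apply] <;> norm_num
  have hch := isChannel_unitaryConj hU
  have hE : unitaryConj U (Matrix.single 0 1 1) = !![12 / 25, -9 / 25; 16 / 25, -12 / 25] := by
    have hs : Matrix.single 0 1 1 = (!![0, 1; 0, 0] : Matrix (Fin 2) (Fin 2) ℂ) := by
      ext i j
      fin_cases i <;> fin_cases j <;> simp
    rw [unitaryConj_apply, hUH, hs]
    ext i j
    fin_cases i <;> fin_cases j <;> simp [U, Matrix.mul_apply] <;> norm_num
  have htr := R.trace_action hch (Matrix.single 0 1 1)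
  have hJ := (jamiolkowski_eq_hadamard_iff two_ne_zero _ _ C).1 (hC.2 _ hch)
  rw [← hR _ hch, Matrix.trace_fin_two, hJ, hJ, hE] at htr
  simp at htr
  linear_combination 25 / 12 * htr

/-! ### Passive memories -/

/-- For a passive memory the entries with equal input indices do not depend on the input. The
superchannel is probed with the channel that prepares the uniform superposition, whose matrix
elements are all nonzero. -/
theorem gram_apply_eq_of_passive {d : ℕ} {G : Matrix (Fin d × Fin d) (Fin d × Fin d) ℂ}
    (hG : G ∈ passiveGrams d) (i j k l : Fin d) : G (i, k) (j, k) = G (i, l) (j, l) := by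
  obtain ⟨Ξ, -, hGΞ, R, hP, hR⟩ := hG
  have hd : d ≠ 0 := (Fin.pos i).ne'
  have hd' : (d : ℂ) ≠ 0 := Nat.cast_ne_zero.2 hd
  let σ : Matrix (Fin d) (Fin d) ℂ := (d : ℂ)⁻¹ • Matrix.vecMulVec 1 (star 1)
  have hσ : IsState σ := by
    refine ⟨(Matrix.posSemidef_vecMulVec_self_star 1).smul ?_, ?_⟩
    · simp
    · simp [σ, Matrix.trace, hd']
  have hch := isChannel_replaceChannel hσ
  have hJ := (jamiolkowski_eq_hadamard_iff hd _ _ G).1 (hGΞ.2 _ hch)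
  have key : Ξ (replaceChannel σ) (Matrix.single k k 1) =
      Ξ (replaceChannel σ) (Matrix.single l l 1) := by
    rw [hR _ hch]
    simp only [Implementation.action, LinearMap.comp_apply, tensorId_replaceChannel]
    congr 3
    exact hP _ _ (isState_single k) (isState_single l)
  have := congrFun (congrFun key i) j
  rw [hJ, hJ, replaceChannel_apply, replaceChannel_apply] at this
  simpa [σ, Matrix.vecMulVec_apply, hd'] using this

/-- A mixture of product phase patterns `v i * w k` has a passive implementation: the memory holds
the classical variable `t` with distribution `p`, the encoder applies the phases `w t`, and the
decoder the phases `v t`. -/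
theorem mem_passiveGrams_of_phases {d : ℕ} {ι : Type} [Fintype ι] (hd : d ≠ 0)
    {p : ι → ℝ} {v w : ι → Fin d → ℂ} (hp : ∀ t, 0 ≤ p t) (hp1 : ∑ t, p t = 1)
    (hv : ∀ t i, v t i * conj (v t i) = 1) (hw : ∀ t k, w t k * conj (w t k) = 1)
    {G : Matrix (Fin d × Fin d) (Fin d × Fin d) ℂ} (hG : IsGram G)
    (hGe : ∀ i k j l, G (i, k) (j, l) =
      ∑ t, (p t : ℂ) * (v t i * w t k * conj (v t j * w t l))) :
    G ∈ passiveGrams d := by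
  classical
  let e := Fintype.equivFin ι
  have hdiag : ∀ u : ι → Fin d → ℂ, (∀ t i, u t i * conj (u t i) = 1) →
      IsChannel (unitaryConj (Matrix.diagonal
        fun x : Fin d × Fin (Fintype.card ι) => u (e.symm x.2) x.1)) := by
    intro u hu
    refine isChannel_unitaryConj ?_
    rw [Matrix.diagonal_conjTranspose, Matrix.diagonal_mul_diagonal, ← Matrix.diagonal_one]
    congr 1
    funext x
    rw [mul_comm]
    exact hu _ _
  let R : Implementation d :=
    { dim' := Fintype.card ι
      dim := Fintype.card ι
      dim'' := Fintype.card ι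
      τ := Matrix.diagonal fun a => (p (e.symm a) : ℂ)
      τ_isState := by
        refine ⟨Matrix.posSemidef_diagonal_iff.2 fun a => ?_, ?_⟩
        · exact_mod_cast hp _
        · rw [Matrix.trace_diagonal, e.symm.sum_comp fun t => (p t : ℂ)]
          exact_mod_cast hp1
      enc := _
      enc_isChannel := hdiag w hw
      dec := _
      dec_isChannel := hdiag v hv }
  have henc : ∀ (ρ : Matrix (Fin d) (Fin d) ℂ) x y, R.enc (ρ ⊗ₖ R.τ) x y =
      w (e.symm x.2) x.1 * (ρ x.1 y.1 * R.τ x.2 y.2) * conj (w (e.symm y.2) y.1) :=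
    fun ρ x y => unitaryConj_diagonal_apply _ _ x y
  have hpass : R.IsPassive := by
    have h : ∀ ρ : Matrix (Fin d) (Fin d) ℂ, IsState ρ → trace₁ (R.enc (ρ ⊗ₖ R.τ)) = R.τ := by
      intro ρ hρ
      ext a b
      simp only [trace₁, Matrix.of_apply, henc]
      by_cases hab : a = b
      · subst hab
        have : ∀ i, w (e.symm a) i * (ρ i i * R.τ a a) * conj (w (e.symm a) i) =
            ρ i i * R.τ a a := fun i => by linear_combination (ρ i i * R.τ a a) * hw (e.symm a) i
        simp only [this]
        rw [← Finset.sum_mul]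
        exact (congrArg (· * R.τ a a) hρ.2).trans (one_mul _)
      · have : R.τ a b = 0 := Matrix.diagonal_apply_ne _ hab
        simp [this]
    exact fun ρ ρ' hρ hρ' => (h ρ hρ).trans (h ρ' hρ').symm
  have hact : ∀ (E : SuperOp (Fin d) (Fin d)) i j k l, R.action E (Matrix.single k l 1) i j =
      E (Matrix.single k l 1) i j * G (i, k) (j, l) := by
    intro E i j k l
    have hblk : ∀ a, blockRight (R.enc (Matrix.single k l 1 ⊗ₖ R.τ)) a a =
        (p (e.symm a) * (w (e.symm a) k * conj (w (e.symm a) l))) • Matrix.single k l (1 : ℂ) := by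
      intro a
      have hτ : R.τ a a = p (e.symm a) := Matrix.diagonal_apply_eq _ _
      ext m n
      simp only [blockRight, Matrix.of_apply, henc, hτ, Matrix.smul_apply, Matrix.single_apply,
        smul_eq_mul]
      split_ifs with h
      · rw [h.1, h.2]; ring
      · ring
    have hdec : ∀ Y x y, R.dec Y x y =
        v (e.symm x.2) x.1 * Y x y * conj (v (e.symm y.2) y.1) :=
      fun Y x y => unitaryConj_diagonal_apply _ _ x y
    change ∑ a, R.dec (tensorId _ E (R.enc (Matrix.single k l 1 ⊗ₖ R.τ))) (i, a) (j, a) = _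
    rw [hGe, Finset.mul_sum, ← e.symm.sum_comp]
    refine Finset.sum_congr rfl fun a _ => ?_
    rw [hdec]
    change _ * E (blockRight (R.enc (Matrix.single k l 1 ⊗ₖ R.τ)) a a) i j * _ = _
    rw [hblk, map_smul, Matrix.smul_apply, smul_eq_mul, map_mul]
    ring
  refine ⟨R.action, ⟨⟨R, fun _ _ => rfl⟩, fun E _ i j => ?_⟩, ⟨hG, fun E _ => ?_⟩, R, hpass,
    fun _ _ => rfl⟩
  · rw [hact, hG.2, mul_one]
  · exact (jamiolkowski_eq_hadamard_iff hd _ _ _).2 (hact E)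

/-! ### Balancing a family of vectors -/

/-- Along the rotation by an angle in `[0, π / 2]` the difference of the two squared moduli goes
from positive to negative. -/
theorem exists_rotation_normSq_eq {n : Type*} {a b : n} {x y : n → ℂ}
    (hx : normSq (x b) < normSq (x a)) (hy : normSq (y a) < normSq (y b)) :
    ∃ c s : ℝ, c ^ 2 + s ^ 2 = 1 ∧ normSq ((c • x + s • y) a) = normSq ((c • x + s • y) b) := by
  let h : ℝ → ℝ := fun θ =>
    normSq ((Real.cos θ • x + Real.sin θ • y) a) - normSq ((Real.cos θ • x + Real.sin θ • y) b)
  have hcont : Continuous h := by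
    simp only [h, Pi.add_apply, Pi.smul_apply]
    fun_prop
  have h0 : h (Real.pi / 2) ≤ 0 := by simp [h]; exact hy.le
  have h1 : 0 ≤ h 0 := by simp [h]; exact hx.le
  obtain ⟨θ, -, hθ⟩ := intermediate_value_Icc' (by positivity : (0 : ℝ) ≤ Real.pi / 2)
    hcont.continuousOn ⟨h0, h1⟩
  exact ⟨Real.cos θ, Real.sin θ, by simp, sub_eq_zero.1 hθ⟩

/-- A family of vectors whose squared moduli at `a` and `b` have equal sums can be replaced by one
that has the same second moments, consists of real combinations of the old vectors, and has equal
moduli at `a` and `b` in each of its members. -/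
theorem exists_balanced_family {ι n : Type*} [Fintype ι] (a b : n) (S : Submodule ℝ (n → ℂ))
    (f : ι → n → ℂ) (hS : ∀ t, f t ∈ S)
    (hf : ∑ t, normSq (f t a) = ∑ t, normSq (f t b)) :
    ∃ g : ι → n → ℂ, (∀ t, g t ∈ S) ∧ (∀ t, normSq (g t a) = normSq (g t b)) ∧
      ∀ k l, ∑ t, g t k * conj (g t l) = ∑ t, f t k * conj (f t l) := by
  classical
  induction hN : (Finset.univ.filter fun t => normSq (f t a) ≠ normSq (f t b)).card
    using Nat.strong_induction_on generalizing f with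
  | _ N ih =>
  by_cases hall : ∀ t, normSq (f t a) = normSq (f t b)
  · exact ⟨f, hS, hall, fun _ _ => rfl⟩
  have hsum : ∑ t, (normSq (f t a) - normSq (f t b)) = 0 := by
    rw [Finset.sum_sub_distrib, hf, sub_self]
  have hne : ∃ t ∈ Finset.univ, normSq (f t a) - normSq (f t b) ≠ 0 := by
    push Not at hall
    obtain ⟨t, ht⟩ := hall
    exact ⟨t, Finset.mem_univ t, sub_ne_zero.2 ht⟩
  obtain ⟨i, -, hi⟩ := Finset.exists_pos_of_sum_zero_of_exists_nonzero _ hsum hne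
  obtain ⟨j, -, hj⟩ := Finset.exists_pos_of_sum_zero_of_exists_nonzero
    (fun t => -(normSq (f t a) - normSq (f t b)))
    (by rw [Finset.sum_neg_distrib, hsum, neg_zero]) (by simpa only [neg_ne_zero] using hne)
  have hi' : normSq (f i b) < normSq (f i a) := by linarith
  have hj' : normSq (f j a) < normSq (f j b) := by linarith
  have hij : i ≠ j := by rintro rfl; linarith
  obtain ⟨c, s, hcs, hu⟩ := exists_rotation_normSq_eq hi' hj'
  have hcs' : (c : ℂ) ^ 2 + (s : ℂ) ^ 2 = 1 := by exact_mod_cast hcs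
  -- Rotating the pair `(f i, f j)` leaves all second moments unchanged.
  let f' : ι → n → ℂ := fun t =>
    if t = i then c • f i + s • f j else if t = j then (-s) • f i + c • f j else f t
  have f'i : f' i = c • f i + s • f j := by simp [f']
  have f'j : f' j = (-s) • f i + c • f j := by simp [f', hij.symm]
  have f'o : ∀ t, t ≠ i → t ≠ j → f' t = f t := fun t h1 h2 => by simp [f', h1, h2]
  have hmom : ∀ k l, ∑ t, f' t k * conj (f' t l) = ∑ t, f t k * conj (f t l) := by
    intro k l
    rw [← sub_eq_zero, ← Finset.sum_sub_distrib, Fintype.sum_eq_add i j hij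
      (fun t ht => by rw [f'o t ht.1 ht.2, sub_self]), f'i, f'j]
    simp only [Pi.add_apply, Pi.smul_apply, real_smul, map_add, map_mul, conj_ofReal, ofReal_neg,
      map_neg]
    linear_combination (f i k * conj (f i l) + f j k * conj (f j l)) * hcs'
  have hnorm : ∀ k, ∑ t, normSq (f' t k) = ∑ t, normSq (f t k) := by
    intro k
    have := hmom k k
    simp only [mul_conj] at this
    exact_mod_cast this
  have hS' : ∀ t, f' t ∈ S := by
    intro t
    simp only [f']
    split_ifs
    · exact S.add_mem (S.smul_mem _ (hS i)) (S.smul_mem _ (hS j))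
    · exact S.add_mem (S.smul_mem _ (hS i)) (S.smul_mem _ (hS j))
    · exact hS t
  -- Position `i` has become balanced, and `i`, `j` were both unbalanced before.
  have hcard : (Finset.univ.filter fun t => normSq (f' t a) ≠ normSq (f' t b)).card < N := by
    rw [← hN]
    refine Finset.card_lt_card (Finset.ssubset_iff_of_subset ?_ |>.2 ⟨i, ?_, ?_⟩)
    · intro t ht
      simp only [Finset.mem_filter, Finset.mem_univ, true_and] at ht ⊢
      by_cases h1 : t = i
      · rw [h1]; exact hi'.ne'
      by_cases h2 : t = j
      · rw [h2]; exact hj'.ne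
      rwa [f'o t h1 h2] at ht
    · simpa using hi'.ne'
    · simp only [Finset.mem_filter, Finset.mem_univ, true_and, not_not, f'i]
      exact hu
  obtain ⟨g, hg, hgb, hgm⟩ := ih _ hcard f' hS' (by rw [hnorm, hnorm, hf]) rfl
  exact ⟨g, hg, hgb, fun k l => (hgm k l).trans (hmom k l)⟩

/-! ### The projection onto the `x`-`y` plane -/

theorem blochProjXY_apply (ρ : Matrix (Fin 2) (Fin 2) ℂ) :
    blochProjXY ρ = !![(ρ 0 0 + ρ 1 1) / 2, ρ 0 1; ρ 1 0, (ρ 0 0 + ρ 1 1) / 2] := by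
  change (1 / 2 : ℂ) •
    (ρ.trace • 1 + (ρ * pauliX).trace • pauliX + (ρ * pauliY).trace • pauliY) = _
  ext i j
  fin_cases i <;> fin_cases j <;>
    simp [pauliX, pauliY, Matrix.trace_fin_two, Matrix.mul_apply] <;> ring_nf <;>
    simp <;> ring

theorem two_mul_norm_sub_le_l1Dist {C G : Matrix (Fin 2 × Fin 2) (Fin 2 × Fin 2) ℂ}
    (hC : C.IsHermitian) (hG : G.IsHermitian) (h : G (0, 0) (1, 0) = G (0, 1) (1, 1)) :
    2 * ‖C (0, 0) (1, 0) - C (0, 1) (1, 1)‖ ≤ l1Dist C G := by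
  have hsymm : ∀ p q, ‖C p q - G p q‖ = ‖C q p - G q p‖ := fun p q => by
    rw [← hC.apply p q, ← hG.apply p q, ← star_sub, norm_star]
  have htri : ‖C (0, 0) (1, 0) - C (0, 1) (1, 1)‖ ≤
      ‖C (0, 0) (1, 0) - G (0, 0) (1, 0)‖ + ‖C (0, 1) (1, 1) - G (0, 1) (1, 1)‖ := by
    rw [h, norm_sub_rev (C (0, 1) (1, 1))]
    exact norm_sub_le_norm_sub_add_norm_sub _ _ _
  have h1 := hsymm (1, 0) (0, 0)
  have h2 := hsymm (1, 1) (0, 1)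
  simp only [l1Dist, Fintype.sum_prod_type, Fin.sum_univ_two]
  have hn := fun p q => norm_nonneg (C p q - G p q)
  linarith [hn (0, 0) (0, 0), hn (0, 0) (0, 1), hn (0, 0) (1, 1), hn (0, 1) (0, 0),
    hn (0, 1) (0, 1), hn (0, 1) (1, 0), hn (1, 0) (0, 1), hn (1, 0) (1, 0), hn (1, 0) (1, 1),
    hn (1, 1) (0, 0), hn (1, 1) (1, 0), hn (1, 1) (1, 1)]

theorem l1Dist_idTensor_blochProjXY {C : Matrix (Fin 2 × Fin 2) (Fin 2 × Fin 2) ℂ}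
    (hC : IsGram C) :
    l1Dist C (idTensor (Fin 2) blochProjXY C) = 2 * ‖C (0, 0) (1, 0) - C (0, 1) (1, 1)‖ := by
  have hent : ∀ p q, idTensor (Fin 2) blochProjXY C p q =
      blochProjXY (blockLeft C p.1 q.1) p.2 q.2 := fun _ _ => rfl
  have hb : ∀ x y : ℂ, ‖x - (x + y) / 2‖ = ‖x - y‖ / 2 := fun x y => by
    rw [show x - (x + y) / 2 = (x - y) / 2 by ring, norm_div]; simp
  have hb' : ∀ x y : ℂ, ‖y - (x + y) / 2‖ = ‖x - y‖ / 2 := fun x y => by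
    rw [add_comm, hb, norm_sub_rev]
  have hsymm : ‖C (1, 0) (0, 0) - C (1, 1) (0, 1)‖ = ‖C (0, 0) (1, 0) - C (0, 1) (1, 1)‖ := by
    rw [← hC.1.1.apply (1, 0), ← hC.1.1.apply (1, 1), ← star_sub, norm_star]
  simp only [l1Dist, Fintype.sum_prod_type, Fin.sum_univ_two, hent, blochProjXY_apply, blockLeft]
  simp [hb, hb', hC.2, hsymm]
  ring

/-- Here `Fin.rev` is the bit flip, so that the second summand is `(X ⊗ X) Cᵀ (X ⊗ X)`. -/
theorem idTensor_blochProjXY_apply {C : Matrix (Fin 2 × Fin 2) (Fin 2 × Fin 2) ℂ}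
    (hC : IsGram C) (hblock : C (0, 0) (0, 1) = C (1, 0) (1, 1)) (p q : Fin 2 × Fin 2) :
    idTensor (Fin 2) blochProjXY C p q =
      (C p q + C (q.1.rev, q.2.rev) (p.1.rev, p.2.rev)) / 2 := by
  have hblock' : C (0, 1) (0, 0) = C (1, 1) (1, 0) := by
    rw [← hC.1.1.apply (0, 1), ← hC.1.1.apply (1, 1), hblock]
  change blochProjXY (blockLeft C p.1 q.1) p.2 q.2 = _
  obtain ⟨i, k⟩ := p
  obtain ⟨j, l⟩ := q
  rw [blochProjXY_apply]
  fin_cases i <;> fin_cases k <;> fin_cases j <;> fin_cases l <;>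
    simp [blockLeft, hC.2, hblock, hblock'] <;> ring

/-! ### Decomposition into product phase patterns -/

/-- The real subspace of vectors fixed by the antiunitary `x ↦ (X ⊗ X) x̄`, where `X` flips a
bit (`Fin.rev` on `Fin 2`). -/
def flipReal : Submodule ℝ (Fin 2 × Fin 2 → ℂ) where
  carrier := {x | ∀ i k, x (i.rev, k.rev) = conj (x (i, k))}
  zero_mem' := by simp
  add_mem' hx hy i k := by simp [hx i k, hy i k]
  smul_mem' c x hx i k := by simp [hx i k]

/-- The average of `C` and its image under the antiunitary symmetry is a sum of dyads of fixed
vectors. -/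
theorem exists_flipReal_family {C : Matrix (Fin 2 × Fin 2) (Fin 2 × Fin 2) ℂ}
    (hC : C.PosSemidef) :
    ∃ (m : ℕ) (f : Fin m × Bool → Fin 2 × Fin 2 → ℂ), (∀ t, f t ∈ flipReal) ∧
      ∀ p q, ∑ t, f t p * conj (f t q) =
        (C p q + C (q.1.rev, q.2.rev) (p.1.rev, p.2.rev)) / 2 := by
  obtain ⟨m, ψ, rfl⟩ := Matrix.posSemidef_iff_eq_sum_vecMulVec.1 hC
  have h2 : conj (2 : ℂ) = 2 := map_ofNat _ 2
  -- With `ψ'` the image of `ψ`, the vectors `(ψ + ψ') / 2` and `i (ψ - ψ') / 2` are fixed, and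
  -- their dyads add up to the average of those of `ψ` and `ψ'`.
  refine ⟨m, fun t p => if t.2 then (ψ t.1 p + conj (ψ t.1 (p.1.rev, p.2.rev))) / 2
    else I * (ψ t.1 p - conj (ψ t.1 (p.1.rev, p.2.rev))) / 2, ?_, fun p q => ?_⟩
  · rintro ⟨t, _ | _⟩ i k <;> simp [h2] <;> ring
  · rw [Fintype.sum_prod_type, Matrix.sum_apply, Matrix.sum_apply, ← Finset.sum_add_distrib,
      Finset.sum_div]
    refine Finset.sum_congr rfl fun t _ => ?_
    simp only [Fintype.sum_bool, Matrix.vecMulVec_apply, Pi.star_apply, if_true,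
      Bool.false_eq_true, if_false, map_div₀, map_add, map_sub, map_mul, conj_I, conj_conj, h2,
      RCLike.star_def]
    linear_combination (-(1 / 4) * (ψ t p - conj (ψ t (p.1.rev, p.2.rev))) *
      (conj (ψ t q) - ψ t (q.1.rev, q.2.rev))) * I_mul_I

/-- A fixed vector with `|x₀₀| = |x₀₁|` is a product of phases up to scale and global phase. -/
theorem exists_phases {x : Fin 2 × Fin 2 → ℂ} (hx : x ∈ flipReal)
    (h : normSq (x (0, 0)) = normSq (x (0, 1))) :
    ∃ v w : Fin 2 → ℂ, (∀ i, v i * conj (v i) = 1) ∧ (∀ k, w k * conj (w k) = 1) ∧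
      ∀ i k j l, x (i, k) * conj (x (j, l)) =
        normSq (x (0, 0)) * (v i * w k * conj (v j * w l)) := by
  have h10 : x (1, 0) = conj (x (0, 1)) := hx 0 1
  have h11 : x (1, 1) = conj (x (0, 0)) := hx 0 0
  -- If `x₀₀ = 0`, the vector vanishes and any phases will do.
  by_cases h0 : x (0, 0) = 0
  · have h1 : x (0, 1) = 0 := by rwa [h0, normSq_zero, eq_comm, normSq_eq_zero] at h
    have hz : ∀ i k, x (i, k) = 0 := by
      intro i k
      fin_cases i <;> fin_cases k <;> simp [h0, h1, h10, h11]
    exact ⟨1, 1, by simp, by simp, by simp [hz]⟩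
  have hc0 : conj (x (0, 0)) ≠ 0 := (map_ne_zero _).2 h0
  have hn : x (0, 1) * conj (x (0, 1)) = x (0, 0) * conj (x (0, 0)) := by
    rw [mul_conj, mul_conj, h]
  -- Normalizing by `x₀₀` itself, and not by its modulus, changes `x` by a global phase, which drops
  -- out of `x xᴴ`.
  refine ⟨![1, conj (x (0, 1)) / x (0, 0)], ![1, x (0, 1) / x (0, 0)], ?_, ?_, ?_⟩
  · intro i
    fin_cases i
    · simp
    · simp; field_simp; linear_combination hn
  · intro k
    fin_cases k
    · simp
    · simp; field_simp; linear_combination hn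
  · have hvw : ∀ i k, x (i, k) = x (0, 0) *
        ((![1, conj (x (0, 1)) / x (0, 0)] : Fin 2 → ℂ) i *
          (![1, x (0, 1) / x (0, 0)] : Fin 2 → ℂ) k) := by
      intro i k
      fin_cases i <;> fin_cases k <;> simp [h10, h11]
      · field_simp
      · field_simp
      · field_simp; linear_combination -hn
    intro i k j l
    rw [hvw i k, hvw j l, ← mul_conj, map_mul]
    ring

theorem idTensor_blochProjXY_mem_passiveGrams {C : Matrix (Fin 2 × Fin 2) (Fin 2 × Fin 2) ℂ}
    (hC : IsGram C) (hblock : C (0, 0) (0, 1) = C (1, 0) (1, 1)) :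
    idTensor (Fin 2) blochProjXY C ∈ passiveGrams 2 := by
  obtain ⟨m, f, hfS, hf⟩ := exists_flipReal_family hC.1
  have hdiag : ∀ p, ∑ t, normSq (f t p) = 1 := by
    intro p
    have := hf p p
    simp only [hC.2, mul_conj] at this
    norm_num at this
    exact_mod_cast this
  obtain ⟨g, hgS, hgb, hg⟩ := exists_balanced_family (0, 0) (0, 1) flipReal f hfS
    ((hdiag _).trans (hdiag _).symm)
  have hL : ∀ p q, idTensor (Fin 2) blochProjXY C p q = ∑ t, g t p * conj (g t q) :=
    fun p q => by rw [idTensor_blochProjXY_apply hC hblock, ← hf, hg]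
  choose v w hv hw hvw using fun t => exists_phases (hgS t) (hgb t)
  refine mem_passiveGrams_of_phases two_ne_zero (p := fun t => normSq (g t (0, 0)))
    (fun t => normSq_nonneg _) ?_ hv hw ⟨?_, fun p => ?_⟩ fun i k j l => ?_
  · have := hg (0, 0) (0, 0)
    simp only [mul_conj] at this
    rw [← hdiag (0, 0)]
    exact_mod_cast this
  · have : idTensor (Fin 2) blochProjXY C = ∑ t, Matrix.vecMulVec (g t) (star (g t)) := by
      ext p q
      rw [hL, Matrix.sum_apply]
      rfl
    rw [this]
    exact Matrix.posSemidef_sum _ fun t _ => Matrix.posSemidef_vecMulVec_self_star _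
  · rw [idTensor_blochProjXY_apply hC hblock, hC.2, hC.2]
    norm_num
  · rw [hL]
    exact Finset.sum_congr rfl fun t _ => hvw t i k j l

end DephasingMemory

open DephasingMemory in
theorem theorem3
    (Ξ : SuperOp (Fin 2) (Fin 2) → SuperOp (Fin 2) (Fin 2))
    (C : Matrix (Fin 2 × Fin 2) (Fin 2 × Fin 2) ℂ)
    (hΞ : IsDephasingSuperchannel Ξ) (hC : IsGramMatrixOf C Ξ) :
    IsLeast (l1Dist C '' passiveGrams 2) (2 * ‖C (0, 0) (1, 0) - C (0, 1) (1, 1)‖) ∧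
    activeMemory C = 2 * ‖C (0, 0) (1, 0) - C (0, 1) (1, 1)‖ ∧
    idTensor (Fin 2) blochProjXY C ∈ passiveGrams 2 ∧
    l1Dist C (idTensor (Fin 2) blochProjXY C) =
      2 * ‖C (0, 0) (1, 0) - C (0, 1) (1, 1)‖ := by
  have hmem := idTensor_blochProjXY_mem_passiveGrams hC.1 (gram_diagonal_blocks_eq hΞ.1 hC)
  have hdist := l1Dist_idTensor_blochProjXY hC.1
  have hleast : IsLeast (l1Dist C '' passiveGrams 2)
      (2 * ‖C (0, 0) (1, 0) - C (0, 1) (1, 1)‖) := by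
    refine ⟨⟨_, hmem, hdist⟩, ?_⟩
    rintro _ ⟨G, hG, rfl⟩
    have hpass := gram_apply_eq_of_passive hG 0 1 0 1
    obtain ⟨_, -, ⟨hGram, -⟩, -⟩ := hG
    exact two_mul_norm_sub_le_l1Dist hC.1.1.1 hGram.1.1 hpass
  exact ⟨hleast, hleast.csInf_eq, hmem, hdist⟩
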